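/- For integers $r,s\ge 0$ with $r+s\ge 1$ and $n=2(r+s)$, let $\mathrm{Cay}(\mathbb{Z}_4^n,(r,s,r,s))$ be the graph with vertex set $\mathbb{Z}_4^n$ in which $v,w$ are adjacent if and only if, among the coordinates of $v-w$, the symbols $0$ and $2$ each occur exactly $r$ times and the symbols $1$ and $3$ each occur exactly $s$ times. For a graph $G$ with vertex set $V$, a quantum $c$-coloring of $G$ is a collection of orthogonal projections $P_{v,i}:\mathbb{C}^d\to\mathbb{C}^d$ ($v\in V$, $1\le i\le c$), for some $d\ge 1$, such that $\sum_{i=1}^{c}P_{v,i}=I_d$ for every $v\in V$, and $P_{v,i}P_{w,i}=0$ for all adjacent $v,w$ and all $i$; the quantum chromatic number $\chi_q(G)$ is the smallest $c$ for which $G$ admits a quantum $c$-coloring. Let $n=2(r+s)$ with $r\ge s$ and $r$ even. Then $$\chi_q\bigl(\mathrm{Cay}(\mathbb{Z}_4^n,(r,s,r,s))\bigr)=n$$ in both of the following regimes: (R1) $s\ge 2$ is fixed and $n$ is large enough; that is, for every $s\ge 2$ there is an $N=N(s)$ such that the equality holds for all such $r$ and $n$ with $n\ge N$. (R2) $s=\alpha\cdot\frac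 n2$ with $0<\alpha\le 0.17$ and $n$ is large enough; that is, there is an absolute constant $N$ such that the equality holds for all real $\alpha\in(0,0.17]$ and all such $r,s,n$ with $s=\alpha n/2$ and $n\ge N$. -/

import Mathlib

/-- The `k`-th Hamming weight of `v ∈ ℤ₄ⁿ`: the number of coordinates equal to `k`. -/
def hammingWt {n : ℕ} (k : ZMod 4) (v : Fin n → ZMod 4) : ℕ :=
  (Finset.univ.filter fun i => v i = k).card

/-- The set of vectors of type `(t₀, t₁, t₂, t₃)` in `ℤ₄ⁿ`, i.e. of those in which the symbol `k`
occurs exactly `t_k` times. -/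
def vectorsOfType (n t₀ t₁ t₂ t₃ : ℕ) : Set (Fin n → ZMod 4) :=
  {v | hammingWt 0 v = t₀ ∧ hammingWt 1 v = t₁ ∧ hammingWt 2 v = t₂ ∧ hammingWt 3 v = t₃}

/-- The Cayley graph of the additive group `ℤ₄ⁿ` generated by the vectors of type `(r, s, r, s)`.
This set is closed under negation and, unless `n = 0`, does not contain `0`, so that for `n > 0`
two vertices `v`, `w` are adjacent in `addCayley` exactly when `v - w` is of this type. -/
def cayleyZ4 (n r s : ℕ) : SimpleGraph (Fin n → ZMod 4) :=
  SimpleGraph.addCayley (vectorsOfType n r s r s)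

/-- A quantum `c`-coloring of `G` on `ℂᵈ`, `d ≥ 1`: orthogonal projections `P v i` (self-adjoint
idempotent matrices), for vertices `v` and colors `i`, that sum to the identity at each vertex and
satisfy `P v i * P w i = 0` for adjacent `v`, `w`. -/
structure QuantumColoring {V : Type*} (G : SimpleGraph V) (c d : ℕ) where
  /-- The dimension is positive: `ℂ⁰` would color every graph with no colors. -/
  dim_pos : 0 < d
  P : V → Fin c → Matrix (Fin d) (Fin d) ℂ
  isStarProjection : ∀ v i, IsStarProjection (P v i)
  sum_eq_one : ∀ v, ∑ i, P v i = 1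
  mul_eq_zero : ∀ v w, G.Adj v w → ∀ i, P v i * P w i = 0

/-- `G` admits a quantum `c`-coloring in some positive finite dimension. -/
def QuantumColorable {V : Type*} (G : SimpleGraph V) (c : ℕ) : Prop :=
  ∃ d : ℕ, Nonempty (QuantumColoring G c d)

/-- The quantum chromatic number: the smallest `c` such that `G` admits a quantum `c`-coloring
(`⊤` if there is none). -/
noncomputable def quantumChromaticNumber {V : Type*} (G : SimpleGraph V) : ℕ∞ :=
  ⨅ c : {c : ℕ // QuantumColorable G c}, ((c : ℕ) : ℕ∞)

/-!
Upper bound: `v ↦ (ω ^ v₁, …, ω ^ vₙ)`, where `ω` is a primitive fourth root of unity, maps adjacent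
vertices to orthogonal vectors with entries of modulus one, and multiplying such vectors by the
columns of the Fourier matrix gives orthonormal bases whose rank-one projections are a coloring.

Lower bound: the Fourier coefficient of a quantum `c`-coloring at the trivial character carries at
least the fraction `1 / c` of its total mass, and the orthogonality relations give Hoffman's bound
`n ≤ c` as soon as every eigenvalue of the graph is at least `-1 / (n - 1)` times its degree. The
eigenvalue of a character `ψ` depends on the number of coordinates `j` with `ψ (e_j) ^ 2 = -1`. If
it is neither `0` nor `n`, the eigenvalue is bounded by a Krawtchouk value `K_{n/2}` of length `n`.
Otherwise it is a positive multiple of `K_{2s}(k)` for some `k`, and symmetry allows `2k ≤ n`.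
Then `K_{2s}(k)` is nonnegative when `4k(n - k) ≤ (n - 4s)²`, by the recursion in the degree. In the
remaining range the orthogonality relation `C(n, k) K_{2s}(k)² ≤ 2ⁿ C(n, 2s)` and entropy bounds for
the binomial coefficients make `n |K_{2s}(k)|` smaller than `C(n, 2s)`; this is where the constant
`0.17` enters. The degrees `2` and `4`, where the entropy bounds are too weak, are computed
explicitly.
-/

section Krawtchouk

open Polynomial Finset

/-- The value at `k` of the Krawtchouk polynomial of degree `t` for the binary Hamming scheme of
length `n`, as a coefficient of its generating function. It is meant for `k ≤ n`, where the
truncated subtraction is harmless. -/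
noncomputable def krawtchouk (n t k : ℕ) : ℤ :=
  ((1 - X) ^ k * (1 + X) ^ (n - k) : ℤ[X]).coeff t

theorem krawtchouk_zero_right (n t : ℕ) : krawtchouk n t 0 = n.choose t := by
  simp [krawtchouk, coeff_one_add_X_pow]

theorem krawtchouk_zero_left (n k : ℕ) : krawtchouk n 0 k = 1 := by
  simp [krawtchouk, coeff_zero_eq_eval_zero]

theorem krawtchouk_one_left {n k : ℕ} (hk : k ≤ n) : krawtchouk n 1 k = n - 2 * k := by
  have h : krawtchouk n 1 k = (derivative ((1 - X) ^ k * (1 + X) ^ (n - k) : ℤ[X])).coeff 0 := by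
    rw [coeff_derivative, krawtchouk]
    simp
  rw [h, coeff_zero_eq_eval_zero]
  simp [derivative_mul, derivative_pow, Nat.cast_sub hk]
  ring

theorem krawtchouk_sub_right {n k : ℕ} (hk : k ≤ n) (t : ℕ) :
    krawtchouk n t (n - k) = (-1) ^ t * krawtchouk n t k := by
  have h : ((1 - X) ^ (n - k) * (1 + X) ^ k : ℤ[X])
      = ((1 - X) ^ k * (1 + X) ^ (n - k) : ℤ[X]).comp (C (-1) * X) := by
    simp [mul_comp, pow_comp, mul_comm, ← sub_eq_add_neg]
  rw [krawtchouk, krawtchouk, Nat.sub_sub_self hk, h, comp_C_mul_X_coeff, mul_comm]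

theorem krawtchouk_add_two_left {n k : ℕ} (hk : k ≤ n) (t : ℕ) :
    ((t : ℤ) + 2) * krawtchouk n (t + 2) k
      = (n - 2 * k) * krawtchouk n (t + 1) k - (n - t) * krawtchouk n t k := by
  obtain ⟨m, rfl⟩ := Nat.exists_eq_add_of_le hk
  have hode : (derivative ((1 - X) ^ k * (1 + X) ^ m) * (1 - X ^ 2) : ℤ[X])
      = ((1 - X) ^ k * (1 + X) ^ m) * (C ((m : ℤ) - k) - C ((k : ℤ) + m) * X) := by
    cases k <;> cases m <;> simp [derivative_mul, derivative_pow] <;> ring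
  have hcoeff := congrArg (fun p => p.coeff (t + 1)) hode
  rw [mul_sub, mul_sub] at hcoeff
  simp only [coeff_sub, mul_one, coeff_derivative, coeff_mul_C, ← mul_assoc, coeff_mul_X]
    at hcoeff
  have hlow : (derivative ((1 - X) ^ k * (1 + X) ^ m) * X ^ 2 : ℤ[X]).coeff (t + 1)
      = t * ((1 - X) ^ k * (1 + X) ^ m : ℤ[X]).coeff t := by
    cases t with
    | zero => simp [pow_two, ← mul_assoc, mul_coeff_zero]
    | succ t => rw [coeff_mul_X_pow, coeff_derivative, Nat.cast_succ, mul_comm]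
  rw [hlow] at hcoeff
  simp only [krawtchouk, Nat.add_sub_cancel_left]
  push_cast at hcoeff ⊢
  linear_combination hcoeff

variable {ι : Type*}

theorem sum_powersetCard_prod (A : Finset ι) (ε : ι → ℤˣ) (t : ℕ) :
    ∑ U ∈ A.powersetCard t, ∏ j ∈ U, (ε j : ℤ) = krawtchouk #A t #{j ∈ A | ε j = -1} := by
  have hprod : ∏ j ∈ A, (1 + C (ε j : ℤ) * X)
      = (1 - X) ^ #{j ∈ A | ε j = -1} * (1 + X) ^ (#A - #{j ∈ A | ε j = -1}) := by
    have hsub : #A - #{j ∈ A | ε j = -1} = #{j ∈ A | ¬ ε j = -1} := by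
      rw [← card_filter_add_card_filter_not (s := A) (fun j => ε j = -1), Nat.add_sub_cancel_left]
    rw [hsub, ← prod_filter_mul_prod_filter_not A (fun j => ε j = -1), ← prod_const, ← prod_const]
    congr 1 <;> refine prod_congr rfl fun j hj => ?_
    · simp [(mem_filter.1 hj).2, sub_eq_add_neg]
    · simp [(Int.units_eq_one_or (ε j)).resolve_right (mem_filter.1 hj).2]
  rw [krawtchouk, ← hprod, prod_one_add, finsetSum_coeff, powersetCard_eq_filter, sum_filter]
  refine sum_congr rfl fun U _ => ?_
  rw [prod_mul_distrib, prod_const, ← map_prod, coeff_C_mul_X_pow]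
  simp only [eq_comm]

variable [DecidableEq ι]

theorem sum_powersetCard_neg_one_pow_card_inter {A K : Finset ι} (hK : K ⊆ A) (t : ℕ) :
    ∑ U ∈ A.powersetCard t, (-1 : ℤ) ^ #(U ∩ K) = krawtchouk #A t #K := by
  have h := sum_powersetCard_prod A (fun j => if j ∈ K then -1 else 1) t
  rw [filter_congr (q := (· ∈ K)) (by simp), filter_mem_eq_inter, inter_eq_right.2 hK] at h
  rw [← h]
  refine sum_congr rfl fun U _ => ?_
  rw [← filter_mem_eq_inter, ← prod_const, prod_filter]
  exact prod_congr rfl fun j _ => by split_ifs <;> rfl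

/-- Both sides count the pairs of a `k`-set and a `t`-set with the sign `(-1) ^ #(U ∩ K)`. -/
theorem choose_mul_krawtchouk_comm (n k t : ℕ) :
    n.choose k * krawtchouk n t k = n.choose t * krawtchouk n k t := by
  have hsum (a b : ℕ) : ∑ K ∈ (range n).powersetCard a, ∑ U ∈ (range n).powersetCard b,
      (-1 : ℤ) ^ #(U ∩ K) = n.choose a * krawtchouk n b a := by
    have hinner : ∀ K ∈ (range n).powersetCard a,
        ∑ U ∈ (range n).powersetCard b, (-1 : ℤ) ^ #(U ∩ K) = krawtchouk n b a := fun K hK => by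
      rw [sum_powersetCard_neg_one_pow_card_inter (mem_powersetCard.1 hK).1, card_range,
        (mem_powersetCard.1 hK).2]
    rw [sum_congr rfl hinner, sum_const, card_powersetCard, card_range, nsmul_eq_mul]
  rw [← hsum, ← hsum, sum_comm]
  simp only [inter_comm]

theorem sum_powerset_neg_one_pow_card_inter_mul {A U V : Finset ι} (hU : U ⊆ A) (hV : V ⊆ A) :
    ∑ K ∈ A.powerset, (-1 : ℤ) ^ #(U ∩ K) * (-1) ^ #(V ∩ K) = if U = V then 2 ^ #A else 0 := by
  have hpow (W K : Finset ι) : (-1 : ℤ) ^ #(W ∩ K) = ∏ j ∈ K, if j ∈ W then -1 else 1 := by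
    rw [inter_comm, ← filter_mem_eq_inter, ← prod_const, prod_filter]
  simp only [hpow, ← prod_mul_distrib]
  rw [← prod_one_add]
  split_ifs with hUV
  · rw [hUV, ← prod_const]
    exact prod_congr rfl fun j _ => by split_ifs <;> rfl
  · obtain ⟨j, hj⟩ : ∃ j, ¬ (j ∈ U ↔ j ∈ V) := by
      by_contra! h
      exact hUV (ext h)
    refine prod_eq_zero (i := j) (by grind) ?_
    by_cases j ∈ U <;> simp_all

theorem sum_choose_mul_krawtchouk_sq (n t : ℕ) :
    ∑ k ∈ range (n + 1), n.choose k * krawtchouk n t k ^ 2 = 2 ^ n * n.choose t := by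
  have hk (k : ℕ) : ∑ K ∈ (range n).powersetCard k,
      (∑ U ∈ (range n).powersetCard t, (-1 : ℤ) ^ #(U ∩ K)) ^ 2
        = n.choose k * krawtchouk n t k ^ 2 := by
    have hinner : ∀ K ∈ (range n).powersetCard k,
        (∑ U ∈ (range n).powersetCard t, (-1 : ℤ) ^ #(U ∩ K)) ^ 2 = krawtchouk n t k ^ 2 :=
      fun K hK => by
        rw [sum_powersetCard_neg_one_pow_card_inter (mem_powersetCard.1 hK).1, card_range,
          (mem_powersetCard.1 hK).2]
    rw [sum_congr rfl hinner, sum_const, card_powersetCard, card_range, nsmul_eq_mul]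
  have hU : ∀ U ∈ (range n).powersetCard t, ∑ V ∈ (range n).powersetCard t,
      ∑ K ∈ (range n).powerset, (-1 : ℤ) ^ #(U ∩ K) * (-1) ^ #(V ∩ K) = 2 ^ n := fun U hU => by
    have hV : ∀ V ∈ (range n).powersetCard t,
        ∑ K ∈ (range n).powerset, (-1 : ℤ) ^ #(U ∩ K) * (-1) ^ #(V ∩ K)
          = if U = V then 2 ^ n else 0 := fun V hV => by
      rw [sum_powerset_neg_one_pow_card_inter_mul (mem_powersetCard.1 hU).1
        (mem_powersetCard.1 hV).1, card_range]
    rw [sum_congr rfl hV, sum_ite_eq, if_pos hU]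
  calc ∑ k ∈ range (n + 1), n.choose k * krawtchouk n t k ^ 2
      = ∑ K ∈ (range n).powerset,
          (∑ U ∈ (range n).powersetCard t, (-1 : ℤ) ^ #(U ∩ K)) ^ 2 := by
        simp only [← hk]
        rw [sum_powerset, card_range]
    _ = ∑ U ∈ (range n).powersetCard t, ∑ V ∈ (range n).powersetCard t,
          ∑ K ∈ (range n).powerset, (-1 : ℤ) ^ #(U ∩ K) * (-1) ^ #(V ∩ K) := by
        simp only [pow_two, sum_mul_sum]
        rw [sum_comm]
        exact sum_congr rfl fun U _ => sum_comm
    _ = 2 ^ n * n.choose t := by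
        rw [sum_congr rfl hU, sum_const, card_powersetCard, card_range, nsmul_eq_mul, mul_comm]

theorem choose_mul_krawtchouk_sq_le {n k : ℕ} (hk : k ≤ n) (t : ℕ) :
    n.choose k * krawtchouk n t k ^ 2 ≤ 2 ^ n * n.choose t := by
  rw [← sum_choose_mul_krawtchouk_sq]
  exact single_le_sum (f := fun k => (n.choose k : ℤ) * krawtchouk n t k ^ 2)
    (fun j _ => by positivity) (mem_range.2 (Nat.lt_succ_of_le hk))

theorem mul_abs_krawtchouk_le_choose {n k t a : ℕ} (hk : k ≤ n)
    (h : 2 ^ n * a ^ 2 ≤ n.choose k * n.choose t) : a * |krawtchouk n t k| ≤ n.choose t := by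
  have hpos : (0 : ℤ) < n.choose k := mod_cast Nat.choose_pos hk
  have h' : (2 : ℤ) ^ n * a ^ 2 ≤ n.choose k * n.choose t := mod_cast h
  refine le_of_sq_le_sq (le_of_mul_le_mul_left ?_ hpos) (Nat.cast_nonneg _)
  calc (n.choose k : ℤ) * (a * |krawtchouk n t k|) ^ 2
      = (a : ℤ) ^ 2 * (n.choose k * krawtchouk n t k ^ 2) := by rw [mul_pow, sq_abs]; ring
    _ ≤ (a : ℤ) ^ 2 * (2 ^ n * n.choose t) :=
        mul_le_mul_of_nonneg_left (choose_mul_krawtchouk_sq_le hk t) (sq_nonneg _)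
    _ = 2 ^ n * (a : ℤ) ^ 2 * n.choose t := by ring
    _ ≤ (n.choose k : ℤ) * n.choose t * n.choose t := by gcongr
    _ = n.choose k * (n.choose t : ℤ) ^ 2 := by ring

theorem krawtchouk_two_mul_self_right (m t : ℕ) :
    krawtchouk (2 * m) t m = (expand ℤ 2 ((1 - X) ^ m)).coeff t := by
  rw [krawtchouk, show 2 * m - m = m by lia, ← mul_pow]
  simp only [map_pow, map_sub, map_one, expand_X]
  ring_nf

theorem krawtchouk_two_mul_add_one_middle {m j : ℕ} (hj : 2 * j + 1 ≤ 2 * m) :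
    krawtchouk (2 * m) m (2 * j + 1) = 0 := by
  have hdual := choose_mul_krawtchouk_comm (2 * m) (2 * j + 1) m
  rw [krawtchouk_two_mul_self_right, coeff_expand two_pos, if_neg (by lia), mul_zero] at hdual
  exact (mul_eq_zero.1 hdual).resolve_left (mod_cast (Nat.choose_pos hj).ne')

theorem choose_mul_krawtchouk_two_mul_middle (m j : ℕ) :
    (2 * m).choose (2 * j) * krawtchouk (2 * m) m (2 * j)
      = (-1) ^ j * m.choose j * (2 * m).choose m := by
  have hcomp : ((1 - X) ^ m : ℤ[X]) = ((1 + X) ^ m : ℤ[X]).comp (C (-1) * X) := by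
    simp [sub_eq_add_neg]
  rw [choose_mul_krawtchouk_comm, krawtchouk_two_mul_self_right, mul_comm 2 j,
    coeff_expand_mul two_pos, hcomp, comp_C_mul_X_coeff, coeff_one_add_X_pow]
  ring

theorem neg_one_pow_mul_krawtchouk_two_mul_middle_nonneg {m j : ℕ} (hj : j ≤ m) :
    0 ≤ (-1) ^ j * krawtchouk (2 * m) m (2 * j) := by
  have hpos : (0 : ℤ) < (2 * m).choose (2 * j) := mod_cast Nat.choose_pos (by lia)
  refine nonneg_of_mul_nonneg_right ?_ hpos
  rw [mul_left_comm, choose_mul_krawtchouk_two_mul_middle, mul_assoc, ← mul_assoc, ← mul_pow]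
  positivity

theorem succ_mul_choose_two_mul_add_two (m j : ℕ) :
    (j + 1) * (2 * j + 1) * (2 * m + 2).choose (2 * j + 2)
      = (m + 1) * (2 * m + 1) * (2 * m).choose (2 * j) := by
  have h₁ := Nat.add_one_mul_choose_eq (2 * m) (2 * j)
  have h₂ := Nat.add_one_mul_choose_eq (2 * m + 1) (2 * j + 1)
  zify at *
  linarith [congrArg (· * (2 * j + 1 : ℤ)) h₂, congrArg (· * (2 * m + 2 : ℤ)) h₁]

theorem two_mul_add_one_mul_choose_le (m j : ℕ) (hj : j < m) :
    (2 * j + 1) * m.choose j ≤ (2 * m).choose (2 * j) := by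
  induction j generalizing m with
  | zero => simp
  | succ j ih =>
    obtain ⟨m, rfl⟩ := Nat.exists_eq_add_one_of_ne_zero (by lia : m ≠ 0)
    have h₁ := succ_mul_choose_two_mul_add_two m j
    have h₂ := Nat.add_one_mul_choose_eq m j
    have h₃ := ih m (by lia)
    refine le_of_mul_le_mul_left ?_ (show 0 < (j + 1) * (2 * j + 1) by positivity)
    calc (j + 1) * (2 * j + 1) * ((2 * (j + 1) + 1) * (m + 1).choose (j + 1))
        = (2 * j + 1) * (2 * j + 3) * ((m + 1).choose (j + 1) * (j + 1)) := by ring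
      _ = (m + 1) * ((2 * j + 3) * ((2 * j + 1) * m.choose j)) := by rw [← h₂]; ring
      _ ≤ (m + 1) * ((2 * m + 1) * (2 * m).choose (2 * j)) := by
        gcongr (m + 1) * (?_ * ?_)
        lia
      _ = _ := by rw [← mul_assoc, ← h₁]; rfl

theorem two_mul_sub_one_mul_choose_le {m j : ℕ} (hj₀ : 0 < j) (hj : j < m) :
    (2 * m - 1) * m.choose j ≤ (2 * m).choose (2 * j) := by
  obtain ⟨m, rfl⟩ := Nat.exists_eq_add_one_of_ne_zero (by lia : m ≠ 0)
  obtain ⟨j, rfl⟩ := Nat.exists_eq_add_one_of_ne_zero hj₀.ne'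
  have h₁ := succ_mul_choose_two_mul_add_two m j
  have h₂ := Nat.add_one_mul_choose_eq m j
  have h₃ := two_mul_add_one_mul_choose_le m j (by lia)
  refine le_of_mul_le_mul_left ?_ (show 0 < (j + 1) * (2 * j + 1) by positivity)
  calc (j + 1) * (2 * j + 1) * ((2 * (m + 1) - 1) * (m + 1).choose (j + 1))
      = (2 * j + 1) * (2 * m + 1) * ((m + 1).choose (j + 1) * (j + 1)) := by
        rw [show 2 * (m + 1) - 1 = 2 * m + 1 by lia]; ring
    _ = (m + 1) * (2 * m + 1) * ((2 * j + 1) * m.choose j) := by rw [← h₂]; ring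
    _ ≤ (m + 1) * (2 * m + 1) * (2 * m).choose (2 * j) := by gcongr
    _ = _ := by rw [← h₁]; rfl

theorem two_mul_sub_one_mul_abs_krawtchouk_middle_le {m k : ℕ} (hk : 0 < k) (hk' : k < 2 * m) :
    (2 * m - 1 : ℤ) * |krawtchouk (2 * m) m k| ≤ (2 * m).choose m := by
  obtain ⟨j, rfl | rfl⟩ := k.even_or_odd'
  · have hpos : (0 : ℤ) < (2 * m).choose (2 * j) := mod_cast Nat.choose_pos hk'.le
    have hbinom : (2 * m - 1 : ℤ) * m.choose j ≤ (2 * m).choose (2 * j) := by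
      have := two_mul_sub_one_mul_choose_le (m := m) (j := j) (by lia) (by lia)
      zify [show 1 ≤ 2 * m by lia] at this
      exact this
    have habs := congrArg abs (choose_mul_krawtchouk_two_mul_middle m j)
    simp only [abs_mul, abs_pow, abs_neg, abs_one, one_pow, one_mul, Nat.abs_cast] at habs
    refine le_of_mul_le_mul_left ?_ hpos
    calc (2 * m).choose (2 * j) * ((2 * m - 1 : ℤ) * |krawtchouk (2 * m) m (2 * j)|)
        = (2 * m - 1 : ℤ) * m.choose j * (2 * m).choose m := by
          linear_combination (2 * m - 1 : ℤ) * habs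
      _ ≤ (2 * m).choose (2 * j) * (2 * m).choose m := by gcongr
  · rw [krawtchouk_two_mul_add_one_middle hk'.le, abs_zero, mul_zero]
    positivity

/-- Along `a j = krawtchouk n j t` the degree recursion keeps the ratio of consecutive terms at
least `(n - 2 * t) * (n - j) / (2 * (n - k) * (j + 1))`. -/
theorem krawtchouk_ratio_le {n k t : ℕ} (hk : 2 * k ≤ n) (ht : 2 * t ≤ n)
    (h : 4 * (k * (n - k) : ℤ) ≤ (n - 2 * t) ^ 2) {j : ℕ} (hj : j + 1 ≤ k) :
    0 ≤ krawtchouk n j t ∧ ((n - 2 * t) * (n - j) : ℤ) * krawtchouk n j t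
      ≤ 2 * (n - k) * (j + 1) * krawtchouk n (j + 1) t := by
  have hx : (0 : ℤ) ≤ n - 2 * t := by lia
  induction j with
  | zero =>
    simp only [zero_add, krawtchouk_zero_left, krawtchouk_one_left (show t ≤ n by lia)]
    refine ⟨zero_le_one, ?_⟩
    push_cast
    nlinarith
  | succ j ih =>
    obtain ⟨h₀, h₁⟩ := ih (by lia)
    have hM : (0 : ℤ) < n - k := by lia
    have hx' : (0 : ℤ) < n - 2 * t := by
      refine hx.lt_of_ne' fun h₀ => ?_
      rw [h₀] at h
      nlinarith
    have hnonneg : 0 ≤ krawtchouk n (j + 1) t := by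
      refine nonneg_of_mul_nonneg_right (h₁.trans' ?_)
        (by positivity : (0 : ℤ) < 2 * (n - k) * (j + 1))
      have : (0 : ℤ) ≤ n - j := by lia
      positivity
    refine ⟨hnonneg, le_of_mul_le_mul_left ?_ hx'⟩
    have hrec := krawtchouk_add_two_left (show t ≤ n by lia) j
    have hcoeff : ((n - 2 * t) ^ 2 * (n - (j + 1)) : ℤ)
        ≤ 2 * (n - k) * (n - 2 * t) ^ 2 - 4 * (n - k) ^ 2 * (j + 1) := by
      have hprod : (0 : ℤ) ≤ (k - (j + 1)) * (n - 2 * k) := mul_nonneg (by lia) (by lia)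
      have : (0 : ℤ) ≤ n - 2 * k + (j + 1) := by lia
      nlinarith [mul_le_mul_of_nonneg_right h this, mul_nonneg hM.le hprod]
    push_cast
    calc ((n - 2 * t) * ((n - 2 * t) * (n - (j + 1)) * krawtchouk n (j + 1) t) : ℤ)
        = (n - 2 * t) ^ 2 * (n - (j + 1)) * krawtchouk n (j + 1) t := by ring
      _ ≤ (2 * (n - k) * (n - 2 * t) ^ 2 - 4 * (n - k) ^ 2 * (j + 1))
            * krawtchouk n (j + 1) t := by gcongr
      _ = 2 * (n - k) * ((n - 2 * t) ^ 2 * krawtchouk n (j + 1) t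
            - 2 * (n - k) * (j + 1) * krawtchouk n (j + 1) t) := by ring
      _ ≤ 2 * (n - k) * ((n - 2 * t) ^ 2 * krawtchouk n (j + 1) t
            - (n - 2 * t) * (n - j) * krawtchouk n j t) := by gcongr
      _ = _ := by linear_combination -2 * (n - k : ℤ) * (n - 2 * t) * hrec

theorem krawtchouk_nonneg {n k t : ℕ} (hk : 2 * k ≤ n) (ht : 2 * t ≤ n)
    (h : 4 * (k * (n - k) : ℤ) ≤ (n - 2 * t) ^ 2) : 0 ≤ krawtchouk n t k := by
  have hdual : 0 ≤ krawtchouk n k t := by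
    rcases k with - | k
    · simp [krawtchouk_zero_left]
    obtain ⟨h₀, h₁⟩ := krawtchouk_ratio_le hk ht h le_rfl
    refine nonneg_of_mul_nonneg_right (h₁.trans' ?_) ?_
    · have : (0 : ℤ) ≤ n - 2 * t := by lia
      have : (0 : ℤ) ≤ n - k := by lia
      positivity
    · have : (0 : ℤ) < n - (k + 1 : ℕ) := by lia
      positivity
  have hpos : (0 : ℤ) < n.choose k := mod_cast Nat.choose_pos (by lia)
  refine nonneg_of_mul_nonneg_right ?_ hpos
  rw [choose_mul_krawtchouk_comm]
  positivity

theorem two_mul_krawtchouk_two {n k : ℕ} (hk : k ≤ n) :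
    2 * krawtchouk n 2 k = (n - 2 * k : ℤ) ^ 2 - n := by
  have h := krawtchouk_add_two_left hk 0
  simp only [krawtchouk_zero_left, zero_add, krawtchouk_one_left hk] at h
  push_cast at h
  linear_combination h

theorem twentyfour_mul_krawtchouk_four {n k : ℕ} (hk : k ≤ n) :
    24 * krawtchouk n 4 k
      = (n - 2 * k : ℤ) ^ 4 - (6 * n - 8) * (n - 2 * k) ^ 2 + 3 * n * (n - 2) := by
  have h₂ := two_mul_krawtchouk_two hk
  have h₃ := krawtchouk_add_two_left hk 1
  have h₄ := krawtchouk_add_two_left hk 2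
  simp only [krawtchouk_one_left hk, Nat.reduceAdd] at h₃ h₄
  push_cast at h₃ h₄
  linear_combination 6 * h₄ + 2 * (n - 2 * k : ℤ) * h₃ + ((n - 2 * k : ℤ) ^ 2 - 3 * (n - 2)) * h₂

theorem neg_choose_le_mul_krawtchouk_two {n k : ℕ} (hk : k ≤ n) :
    -(n.choose 2 : ℤ) ≤ (n - 1) * krawtchouk n 2 k := by
  have hchoose := two_mul_krawtchouk_two (Nat.zero_le n)
  rw [krawtchouk_zero_right, Nat.cast_zero] at hchoose
  have hkraw := two_mul_krawtchouk_two hk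
  rcases n with - | n
  · simp [krawtchouk_zero_right, Nat.le_zero.1 hk]
  · have : (0 : ℤ) ≤ n * (((n + 1 : ℕ) : ℤ) - 2 * k) ^ 2 := by positivity
    push_cast at *
    nlinarith

theorem neg_choose_le_mul_krawtchouk_four {n k : ℕ} (hn : 20 ≤ n) (hk : k ≤ n) :
    -(n.choose 4 : ℤ) ≤ (n - 1) * krawtchouk n 4 k := by
  have hchoose := twentyfour_mul_krawtchouk_four (Nat.zero_le n)
  rw [krawtchouk_zero_right, Nat.cast_zero] at hchoose
  have hn' : (20 : ℤ) ≤ n := mod_cast hn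
  have hmin : -(6 * n ^ 2 - 18 * n + 16 : ℤ) ≤ 24 * krawtchouk n 4 k := by
    rw [twentyfour_mul_krawtchouk_four hk]
    linarith [sq_nonneg ((n - 2 * k : ℤ) ^ 2 - (3 * n - 4))]
  have hlarge : (6 * n ^ 2 - 18 * n + 16 : ℤ) ≤ n * (n - 2) * (n - 3) := by
    nlinarith [mul_nonneg (sub_nonneg.2 hn') (sq_nonneg (n : ℤ))]
  have hpos : (0 : ℤ) ≤ n - 1 := by lia
  linarith [mul_le_mul_of_nonneg_left hmin hpos, mul_le_mul_of_nonneg_left hlarge hpos]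

end Krawtchouk

section Entropy

open Real Filter

theorem log_one_add_le {u : ℝ} (hu : -1 < u) : log (1 + u) ≤ u - u ^ 2 / 2 + u ^ 3 / 3 := by
  let f : ℝ → ℝ := fun x => x - x ^ 2 / 2 + x ^ 3 / 3 - log (1 + x)
  have hderiv : ∀ x : ℝ, -1 < x → HasDerivAt f (x ^ 3 / (1 + x)) x := fun x hx => by
    have hx₀ : 1 + x ≠ 0 := by linarith
    have hpoly := ((hasDerivAt_id x).sub (((hasDerivAt_id x).pow 2).div_const 2)).add
      (((hasDerivAt_id x).pow 3).div_const 3)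
    refine (hpoly.sub (((hasDerivAt_id x).const_add 1).log hx₀)).congr_deriv ?_
    simp only [id]
    field
  have hcont : ∀ s : Set ℝ, s ⊆ Set.Ioi (-1) → ContinuousOn f s := fun s hs x hx =>
    (hderiv x (hs hx)).continuousAt.continuousWithinAt
  suffices f 0 ≤ f u by simpa [f, sub_nonneg] using this
  rcases le_total 0 u with h | h
  · refine monotoneOn_of_hasDerivWithinAt_nonneg (convex_Ici 0) (f' := fun x => x ^ 3 / (1 + x))
      (hcont _ fun x hx => ?_) (fun x hx => ?_) (fun x hx => ?_) Set.self_mem_Ici h h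
    · exact neg_one_lt_zero.trans_le (Set.mem_Ici.1 hx)
    · rw [interior_Ici] at hx
      exact (hderiv x (neg_one_lt_zero.trans hx)).hasDerivWithinAt
    · rw [interior_Ici] at hx
      have : 0 < x := hx
      positivity
  · refine antitoneOn_of_hasDerivWithinAt_nonpos (convex_Ioc (-1) 0)
      (f' := fun x => x ^ 3 / (1 + x)) (hcont _ fun x hx => hx.1) (fun x hx => ?_)
      (fun x hx => ?_) ⟨hu, h⟩ ⟨neg_one_lt_zero, le_rfl⟩ h
    · exact (hderiv x (interior_subset hx).1).hasDerivWithinAt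
    · obtain ⟨hx, hx₀⟩ := interior_subset hx
      exact div_nonpos_of_nonpos_of_nonneg (Odd.pow_nonpos ⟨1, rfl⟩ hx₀) (by linarith)

theorem log_two_sub_le_binEntropy {q : ℝ} (hq₀ : 0 < q) (hq₁ : q < 1) :
    log 2 - ((1 - 2 * q) ^ 2 / 2 + (1 - 2 * q) ^ 4 / 3) ≤ binEntropy q := by
  have h₁ := log_one_add_le (u := 1 - 2 * q) (by linarith)
  have h₂ := log_one_add_le (u := -(1 - 2 * q)) (by linarith)
  rw [show 1 + (1 - 2 * q) = 2 * (1 - q) by ring, log_mul two_ne_zero (by linarith)] at h₁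
  rw [show 1 + -(1 - 2 * q) = 2 * q by ring, log_mul two_ne_zero hq₀.ne'] at h₂
  rw [binEntropy, log_inv, log_inv]
  linarith [mul_le_mul_of_nonneg_left h₁ (sub_pos.2 hq₁).le, mul_le_mul_of_nonneg_left h₂ hq₀.le]

theorem negMulLog_add_le_binEntropy {p : ℝ} (hp : p < 1) :
    negMulLog p + p * (1 - p) ≤ binEntropy p := by
  have h := mul_le_mul_of_nonneg_left (log_le_sub_one_of_pos (sub_pos.2 hp)) (sub_pos.2 hp).le
  rw [binEntropy, log_inv, log_inv, negMulLog]
  linarith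

theorem log_two_add_le_binEntropy_add_binEntropy {q τ : ℝ} (hτ₀ : 0 ≤ τ) (hτ : τ ≤ 0.17)
    (h : (1 - 2 * q) ^ 2 ≤ 4 * τ * (1 - τ)) :
    log 2 + (negMulLog τ - 1.76 * τ) ≤ binEntropy q + binEntropy τ := by
  have hu : (1 - 2 * q) ^ 2 ≤ 0.5644 := h.trans (by nlinarith)
  have hq := log_two_sub_le_binEntropy (q := q) (by nlinarith) (by nlinarith)
  have hτ' := negMulLog_add_le_binEntropy (hτ.trans_lt (by norm_num : (0.17 : ℝ) < 1))
  have hu₄ := mul_le_mul_of_nonneg_left hu (sq_nonneg (1 - 2 * q))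
  nlinarith

theorem lt_neg_log_seventeen_hundredths : 1.76 < -log 0.17 := by
  rw [← log_inv, lt_log_iff_exp_lt (by norm_num)]
  refine lt_of_pow_lt_pow_left₀ 25 (by norm_num) ?_
  calc exp 1.76 ^ 25 = exp 1 ^ 44 := by rw [← exp_nat_mul, ← exp_nat_mul]; norm_num
    _ ≤ 2.7182818286 ^ 44 := pow_le_pow_left₀ (exp_pos _).le exp_one_lt_d9.le _
    _ < (0.17⁻¹ : ℝ) ^ 25 := by norm_num

theorem eventually_mul_log_add_one_le_mul {a c : ℝ} (ha : 0 ≤ a) (hc : 0 < c) :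
    ∀ᶠ x : ℝ in atTop, a * log (x + 1) ≤ c * x := by
  have hlog := (isLittleO_log_id_atTop.comp_tendsto
    (tendsto_atTop_add_const_right atTop (1 : ℝ) tendsto_id)).bound
    (show 0 < c / (2 * (a + 1)) by positivity)
  filter_upwards [hlog, eventually_ge_atTop 1] with x hx hx₁
  simp only [Function.comp_apply, id, norm_eq_abs, abs_of_pos (show 0 < x + 1 by linarith)] at hx
  calc a * log (x + 1) ≤ a * (c / (2 * (a + 1)) * (x + 1)) := by
        gcongr
        exact (le_abs_self _).trans hx
    _ ≤ (a + 1) * (c / (2 * (a + 1)) * (2 * x)) := by gcongr <;> linarith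
    _ = c * x := by field

theorem eventually_mul_log_add_one_add_le_mul_log {a b : ℝ} (ha : 0 ≤ a) (hab : a < b) (c : ℝ) :
    ∀ᶠ x : ℝ in atTop, a * log (x + 1) + c ≤ b * log x := by
  filter_upwards [(tendsto_log_atTop.const_mul_atTop (sub_pos.2 hab)).eventually_ge_atTop
    (a * log 2 + c), eventually_ge_atTop 1] with x hx hx₁
  have hlog : log (x + 1) ≤ log 2 + log x := by
    rw [← log_mul two_ne_zero (by linarith)]
    exact log_le_log (by linarith) (by linarith)
  linarith [mul_le_mul_of_nonneg_left hlog ha]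

/-- The right-hand side is concave in `t`, so only the ends `t = 6` and `t = 0.17 * n` matter. -/
theorem eventually_four_mul_log_add_one_le :
    ∀ᶠ x : ℝ in atTop, ∀ t : ℝ, 6 ≤ t → t ≤ 0.17 * x →
      4 * log (x + 1) ≤ x * (negMulLog (t / x) - 1.76 * (t / x)) := by
  have hc := lt_neg_log_seventeen_hundredths
  filter_upwards [eventually_gt_atTop 0,
    eventually_mul_log_add_one_add_le_mul_log (b := 6) zero_le_four (by norm_num)
      (6 * log 6 + 10.56),
    eventually_mul_log_add_one_le_mul (c := 0.17 * (-log 0.17 - 1.76)) zero_le_four (by linarith)]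
    with x hx hleft hright t ht₆ ht
  have hconc : ConcaveOn ℝ (Set.Ici (0 : ℝ)) fun y => negMulLog y - 1.76 * y :=
    concaveOn_negMulLog.sub ((LinearMap.mul ℝ ℝ 1.76).convexOn (convex_Ici 0))
  have hmin := hconc.min_le_of_mem_Icc (x := 6 / x) (y := 0.17) (z := t / x)
    (Set.mem_Ici.2 (by positivity)) (Set.mem_Ici.2 (by norm_num))
    ⟨by gcongr, by rwa [div_le_iff₀ hx]⟩
  refine le_trans ?_ (mul_le_mul_of_nonneg_left hmin hx.le)
  rw [mul_min_of_nonneg _ _ hx.le, le_min_iff]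
  constructor
  · have hend : x * (negMulLog (6 / x) - 1.76 * (6 / x)) = 6 * log x - 6 * log 6 - 10.56 := by
      rw [negMulLog, log_div (by norm_num) hx.ne']
      field_simp
      ring
    linarith
  · rw [negMulLog]
    linarith

theorem factorial_mul_pow_le_factorial_mul_pow (k j : ℕ) :
    k.factorial * k ^ j ≤ j.factorial * k ^ k := by
  rcases le_total k j with h | h
  · calc k.factorial * k ^ j = k.factorial * k ^ (j - k) * k ^ k := by
          rw [mul_assoc, ← pow_add, Nat.sub_add_cancel h]
      _ ≤ j.factorial * k ^ k := Nat.mul_le_mul_right _ (Nat.factorial_mul_pow_sub_le_factorial h)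
  · have hdesc : k.factorial ≤ j.factorial * k ^ (k - j) := by
      rw [← Nat.factorial_mul_descFactorial (Nat.sub_le k j), Nat.sub_sub_self h]
      exact Nat.mul_le_mul_left _ (Nat.descFactorial_le_pow _ _)
    calc k.factorial * k ^ j ≤ j.factorial * k ^ (k - j) * k ^ j := Nat.mul_le_mul_right _ hdesc
      _ = j.factorial * k ^ k := by rw [mul_assoc, ← pow_add, Nat.sub_add_cancel h]

/-- The binomial distribution with parameters `n` and `k / n` has its mode at `k`. -/
theorem pow_mul_pow_mul_choose_le {n k j : ℕ} (hk : k ≤ n) (hj : j ≤ n) :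
    k ^ j * (n - k) ^ (n - j) * n.choose j ≤ n.choose k * (k ^ k * (n - k) ^ (n - k)) := by
  have hfact := Nat.mul_le_mul (factorial_mul_pow_le_factorial_mul_pow k j)
    (factorial_mul_pow_le_factorial_mul_pow (n - k) (n - j))
  have hchoose := (Nat.choose_mul_factorial_mul_factorial hj).trans
    (Nat.choose_mul_factorial_mul_factorial hk).symm
  have hpos : 0 < k.factorial * (n - k).factorial * (j.factorial * (n - j).factorial) := by
    positivity
  refine le_of_mul_le_mul_left ?_ hpos
  calc _ = (n.choose j * j.factorial * (n - j).factorial) *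
          (k.factorial * k ^ j * ((n - k).factorial * (n - k) ^ (n - j))) := by ring
    _ ≤ (n.choose j * j.factorial * (n - j).factorial) *
          (j.factorial * k ^ k * ((n - j).factorial * (n - k) ^ (n - k))) :=
      Nat.mul_le_mul_left _ hfact
    _ = _ := by rw [hchoose]; ring

theorem pow_self_le_succ_mul_choose {n k : ℕ} (hk : k ≤ n) :
    n ^ n ≤ (n + 1) * (n.choose k * (k ^ k * (n - k) ^ (n - k))) := by
  have hsum : n ^ n = ∑ j ∈ Finset.range (n + 1), k ^ j * (n - k) ^ (n - j) * n.choose j := by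
    simpa only [Nat.add_sub_cancel' hk, Nat.cast_id] using add_pow k (n - k) n
  rw [hsum]
  refine (Finset.sum_le_card_nsmul _ _ _ fun j hj =>
    pow_mul_pow_mul_choose_le hk (Nat.lt_succ_iff.1 (Finset.mem_range.1 hj))).trans_eq ?_
  rw [Finset.card_range, smul_eq_mul]

theorem mul_binEntropy_le_log_choose_add_log {n k : ℕ} (hk : k ≤ n) :
    n * binEntropy (k / n) ≤ log (n.choose k) + log (n + 1) := by
  rcases n.eq_zero_or_pos with rfl | hn
  · simp [Nat.le_zero.1 hk]
  have hn' : (n : ℝ) ≠ 0 := by positivity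
  have hmul (a : ℝ) : n * negMulLog (a / n) = a * log n - a * log a := by
    rcases eq_or_ne a 0 with rfl | ha
    · simp
    · rw [negMulLog, log_div ha hn']
      field
  have hentropy : n * binEntropy (k / n) = n * log n - k * log k - (n - k) * log (n - k) := by
    rw [binEntropy_eq_negMulLog_add_negMulLog_one_sub, mul_add, hmul,
      show (1 : ℝ) - k / n = (n - k) / n by field, hmul]
    ring
  have hpow : (n : ℝ) ^ n ≤ (n + 1) * (n.choose k * (k ^ k * ((n - k : ℕ) : ℝ) ^ (n - k))) :=
    mod_cast pow_self_le_succ_mul_choose hk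
  have hchoose : (n.choose k : ℝ) ≠ 0 := mod_cast (Nat.choose_pos hk).ne'
  have hself (a : ℕ) : (a : ℝ) ^ a ≠ 0 := mod_cast (Nat.pow_self_pos (n := a)).ne'
  have hlog := log_le_log (by positivity) hpow
  rw [log_mul (by positivity) (by simp [hchoose, hself]), log_mul hchoose (by simp [hself]),
    log_mul (hself k) (hself _), log_pow, log_pow, log_pow, Nat.cast_sub hk] at hlog
  linarith

theorem two_pow_mul_sq_le_choose_mul_choose {n k t : ℕ} (hk : k ≤ n) (ht : t ≤ n)
    (h : n * log 2 + 4 * log (n + 1) ≤ n * (binEntropy (k / n) + binEntropy (t / n))) :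
    2 ^ n * (n + 1) ^ 2 ≤ n.choose k * n.choose t := by
  have hck : (0 : ℝ) < n.choose k := mod_cast Nat.choose_pos hk
  have hct : (0 : ℝ) < n.choose t := mod_cast Nat.choose_pos ht
  have hlog : log (2 ^ n * (n + 1) ^ 2) ≤ log (n.choose k * n.choose t) := by
    rw [log_mul (by positivity) (by positivity), log_mul hck.ne' hct.ne', log_pow, log_pow,
      Nat.cast_two]
    linarith [mul_binEntropy_le_log_choose_add_log hk, mul_binEntropy_le_log_choose_add_log ht]
  exact_mod_cast (log_le_log_iff (by positivity) (by positivity)).1 hlog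

theorem eventually_two_pow_mul_sq_le_choose_mul_choose :
    ∀ᶠ n : ℕ in atTop, ∀ k t : ℕ, k ≤ n → 6 ≤ t → (t : ℝ) ≤ 0.17 * n →
      (n - 2 * t : ℤ) ^ 2 ≤ 4 * (k * (n - k)) →
        2 ^ n * (n + 1) ^ 2 ≤ n.choose k * n.choose t := by
  filter_upwards [tendsto_natCast_atTop_atTop.eventually eventually_four_mul_log_add_one_le,
    eventually_gt_atTop 0] with n hn hn₀ k t hk ht₆ ht h
  have hn₀' : (0 : ℝ) < n := mod_cast hn₀
  have htn : t ≤ n := by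
    have : (t : ℝ) ≤ n := by linarith
    exact_mod_cast this
  have hreal : (n - 2 * t : ℝ) ^ 2 ≤ 4 * (k * (n - k)) := mod_cast h
  have hratio : (1 - 2 * (k / n : ℝ)) ^ 2 ≤ 4 * (t / n) * (1 - t / n) := by
    calc (1 - 2 * (k / n : ℝ)) ^ 2 = (n - 2 * k : ℝ) ^ 2 / n ^ 2 := by field
      _ ≤ 4 * t * (n - t : ℝ) / n ^ 2 := by gcongr; linarith
      _ = 4 * (t / n : ℝ) * (1 - t / n) := by field
  have hsum := log_two_add_le_binEntropy_add_binEntropy (by positivity)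
    ((div_le_iff₀ hn₀').2 ht) hratio
  refine two_pow_mul_sq_le_choose_mul_choose hk htn ?_
  linarith [mul_le_mul_of_nonneg_left hsum hn₀'.le, hn t (mod_cast ht₆) ht]

theorem eventually_neg_choose_le_mul_krawtchouk :
    ∀ᶠ n : ℕ in atTop, ∀ t k : ℕ, Even t → (t : ℝ) ≤ 0.17 * n → k ≤ n →
      -(n.choose t : ℤ) ≤ (n - 1) * krawtchouk n t k := by
  filter_upwards [eventually_two_pow_mul_sq_le_choose_mul_choose, eventually_ge_atTop 20]
    with n hchoose hn₂₀ t k ht_even ht hk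
  have hn₀ : (0 : ℝ) < n := by positivity
  have htn : 2 * t ≤ n := by
    have : (2 : ℝ) * t ≤ n := by linarith
    exact_mod_cast this
  have hnonneg (h : 0 ≤ krawtchouk n t k) : -(n.choose t : ℤ) ≤ (n - 1) * krawtchouk n t k :=
    (neg_nonpos.2 (Nat.cast_nonneg _)).trans (mul_nonneg (by lia) h)
  wlog hk₂ : 2 * k ≤ n generalizing k
  · have hsymm := krawtchouk_sub_right hk t
    rw [ht_even.neg_one_pow, one_mul] at hsymm
    exact hsymm ▸ this (n - k) (Nat.sub_le n k) (hsymm ▸ hnonneg) (by lia)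
  obtain rfl | rfl | rfl | ht₆ : t = 0 ∨ t = 2 ∨ t = 4 ∨ 6 ≤ t := by grind
  · exact hnonneg (by simp [krawtchouk_zero_left])
  · exact neg_choose_le_mul_krawtchouk_two hk
  · exact neg_choose_le_mul_krawtchouk_four hn₂₀ hk
  rcases le_or_gt (4 * (k * (n - k)) : ℤ) ((n - 2 * t) ^ 2) with hlow | hhigh
  · exact hnonneg (krawtchouk_nonneg hk₂ htn hlow)
  have habs := mul_abs_krawtchouk_le_choose (a := n + 1) hk
    (hchoose k t hk ht₆ ht hhigh.le)
  push_cast at habs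
  nlinarith [neg_abs_le (krawtchouk n t k), abs_nonneg (krawtchouk n t k)]

end Entropy

section SplitSets

open Finset

variable {ι : Type*} [Fintype ι] [DecidableEq ι]

/-- The subsets of `ι` with exactly `a` elements in `T` and `b` elements outside `T`. -/
def splitSets (a b : ℕ) (T : Finset ι) : Finset (Finset ι) :=
  {W | #(W ∩ T) = a ∧ #(W \ T) = b}

variable {a b : ℕ} {T W : Finset ι}

theorem mem_splitSets : W ∈ splitSets a b T ↔ #(W ∩ T) = a ∧ #(W \ T) = b := by
  simp [splitSets]

theorem card_of_mem_splitSets (hW : W ∈ splitSets a b T) : #W = a + b := by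
  rw [← card_inter_add_card_sdiff W T, (mem_splitSets.1 hW).1, (mem_splitSets.1 hW).2]

theorem sum_splitSets {M : Type*} [AddCommMonoid M] (a b : ℕ) (T : Finset ι)
    (f : Finset ι → M) :
    ∑ W ∈ splitSets a b T, f W = ∑ U ∈ T.powersetCard a, ∑ V ∈ Tᶜ.powersetCard b, f (U ∪ V) := by
  have hsplit : ∀ p ∈ T.powersetCard a ×ˢ Tᶜ.powersetCard b,
      (p.1 ∪ p.2) ∩ T = p.1 ∧ (p.1 ∪ p.2) \ T = p.2 := fun p hp => by
    obtain ⟨hU, hV⟩ := mem_product.1 hp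
    have hU := (mem_powersetCard.1 hU).1
    have hV := subset_compl_iff_disjoint_right.1 (mem_powersetCard.1 hV).1
    rw [union_inter_distrib_right, union_sdiff_distrib, inter_eq_left.2 hU,
      disjoint_iff_inter_eq_empty.1 hV, sdiff_eq_empty_iff_subset.2 hU, sdiff_eq_left.2 hV,
      union_empty, empty_union]
    exact ⟨rfl, rfl⟩
  rw [← sum_product']
  refine sum_nbij' (fun W => (W ∩ T, W \ T)) (fun p => p.1 ∪ p.2) ?_ ?_ ?_ ?_ ?_
  · intro W hW
    obtain ⟨hWa, hWb⟩ := mem_splitSets.1 hW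
    exact mem_product.2 ⟨mem_powersetCard.2 ⟨inter_subset_right, hWa⟩,
      mem_powersetCard.2 ⟨sdiff_eq_inter_compl W T ▸ inter_subset_right, hWb⟩⟩
  · intro p hp
    obtain ⟨hU, hV⟩ := mem_product.1 hp
    rw [mem_splitSets, (hsplit p hp).1, (hsplit p hp).2]
    exact ⟨(mem_powersetCard.1 hU).2, (mem_powersetCard.1 hV).2⟩
  · exact fun W _ => sup_inf_sdiff W T
  · exact fun p hp => Prod.ext (hsplit p hp).1 (hsplit p hp).2
  · exact fun W _ => congrArg f (sup_inf_sdiff W T).symm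

theorem card_splitSets (a b : ℕ) (T : Finset ι) :
    #(splitSets a b T) = (#T).choose a * (#Tᶜ).choose b := by
  rw [card_eq_sum_ones, sum_splitSets]
  simp

theorem sum_splitSets_prod (a b : ℕ) (T : Finset ι) (ε : ι → ℤˣ) :
    ∑ W ∈ splitSets a b T, ∏ j ∈ W, (ε j : ℤ)
      = krawtchouk #T a #{j ∈ T | ε j = -1} * krawtchouk #Tᶜ b #{j ∈ Tᶜ | ε j = -1} := by
  rw [sum_splitSets, ← sum_powersetCard_prod, ← sum_powersetCard_prod, sum_mul_sum]
  refine sum_congr rfl fun U hU => sum_congr rfl fun V hV => prod_union ?_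
  exact disjoint_compl_right.mono (mem_powersetCard.1 hU).1 (mem_powersetCard.1 hV).1

variable {r s : ℕ}

theorem mem_powersetCard_and_mem_splitSets_comm :
    T ∈ powersetCard (2 * s) univ ∧ W ∈ splitSets s r T ↔
      T ∈ splitSets s s W ∧ W ∈ powersetCard (r + s) univ := by
  have hT := card_inter_add_card_sdiff T W
  have hW := card_inter_add_card_sdiff W T
  rw [inter_comm] at hT
  rw [mem_powersetCard_univ, mem_powersetCard_univ, mem_splitSets, mem_splitSets, inter_comm T W]
  omega

theorem sum_sum_splitSets_prod (hι : Fintype.card ι = 2 * (r + s)) (ε : ι → ℤˣ) :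
    ∑ T ∈ powersetCard (2 * s) univ, ∑ W ∈ splitSets s r T, ∏ j ∈ W, (ε j : ℤ)
      = (r + s).choose s ^ 2 * krawtchouk (2 * (r + s)) (r + s) #{j | ε j = -1} := by
  rw [sum_comm' fun _ _ => mem_powersetCard_and_mem_splitSets_comm, ← hι, ← card_univ,
    ← sum_powersetCard_prod, mul_sum]
  refine sum_congr rfl fun W hW => ?_
  have hW := mem_powersetCard_univ.1 hW
  have hWc : #Wᶜ = r + s := by rw [card_compl]; omega
  rw [sum_const, card_splitSets, hW, hWc, nsmul_eq_mul, Nat.cast_mul, sq]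

theorem neg_one_pow_mul_sum_splitSets_prod_nonneg (hι : Fintype.card ι = 2 * (r + s))
    (hT : #T = 2 * s) (ε : ι → ℤˣ) :
    0 ≤ (-1) ^ (#{j | ε j = -1} / 2) * ∑ W ∈ splitSets s r T, ∏ j ∈ W, (ε j : ℤ) := by
  have hTc : #Tᶜ = 2 * r := by rw [card_compl]; omega
  have hcard : #{j ∈ T | ε j = -1} + #{j ∈ Tᶜ | ε j = -1} = #{j | ε j = -1} := by
    rw [← card_union_of_disjoint (disjoint_filter_filter disjoint_compl_right), ← filter_union,
      union_compl]
  have hi : #{j ∈ T | ε j = -1} ≤ 2 * s := hT ▸ card_filter_le T _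
  have hl : #{j ∈ Tᶜ | ε j = -1} ≤ 2 * r := hTc ▸ card_filter_le Tᶜ _
  rw [sum_splitSets_prod, hT, hTc, ← hcard]
  generalize #{j ∈ T | ε j = -1} = i at hi ⊢
  generalize #{j ∈ Tᶜ | ε j = -1} = l at hl ⊢
  rcases Nat.even_or_odd' i with ⟨i, rfl | rfl⟩
  · rcases Nat.even_or_odd' l with ⟨l, rfl | rfl⟩
    · rw [← mul_add, Nat.mul_div_cancel_left _ two_pos, pow_add, mul_mul_mul_comm]
      exact mul_nonneg (neg_one_pow_mul_krawtchouk_two_mul_middle_nonneg (by omega))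
        (neg_one_pow_mul_krawtchouk_two_mul_middle_nonneg (by omega))
    · rw [krawtchouk_two_mul_add_one_middle hl, mul_zero, mul_zero]
  · rw [krawtchouk_two_mul_add_one_middle hi, zero_mul, mul_zero]

end SplitSets

section CharacterSums

open Finset

/-- Vectors over `ℤ₄` as pairs of sets of coordinates: `(T, W)` stands for `1_T + 2 · 1_W`. -/
def pairEquivVec (ι : Type*) [Fintype ι] [DecidableEq ι] :
    Finset ι × Finset ι ≃ (ι → ZMod 4) where
  toFun p j := (if j ∈ p.1 then 1 else 0) + (if j ∈ p.2 then 2 else 0)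
  invFun v := (univ.filter fun j => v j = 1 ∨ v j = 3, univ.filter fun j => v j = 2 ∨ v j = 3)
  left_inv := by
    rintro ⟨T, W⟩
    ext j <;> by_cases hT : j ∈ T <;> by_cases hW : j ∈ W <;>
      simp only [mem_filter, mem_univ, hT, hW, if_true, if_false] <;> decide
  right_inv := by
    intro v
    ext j
    simp only [mem_filter, mem_univ, true_and]
    generalize v j = x
    revert x
    decide

theorem hammingWt_pairEquivVec {n : ℕ} (T W : Finset (Fin n)) :
    hammingWt 0 (pairEquivVec (Fin n) (T, W)) = #(T ∪ W)ᶜ ∧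
      hammingWt 1 (pairEquivVec (Fin n) (T, W)) = #(T \ W) ∧
      hammingWt 2 (pairEquivVec (Fin n) (T, W)) = #(W \ T) ∧
      hammingWt 3 (pairEquivVec (Fin n) (T, W)) = #(W ∩ T) := by
  refine ⟨?_, ?_, ?_, ?_⟩ <;> refine congrArg card (ext fun j => ?_) <;> rw [mem_filter] <;>
    by_cases hT : j ∈ T <;> by_cases hW : j ∈ W <;>
    simp only [pairEquivVec, Equiv.coe_fn_mk, mem_univ, mem_compl, mem_union, mem_sdiff, mem_inter,
      hT, hW, if_true, if_false] <;> decide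

theorem pairEquivVec_mem_vectorsOfType {n r s : ℕ} (hn : n = 2 * (r + s)) (T W : Finset (Fin n)) :
    pairEquivVec (Fin n) (T, W) ∈ vectorsOfType n r s r s ↔
      T ∈ powersetCard (2 * s) univ ∧ W ∈ splitSets s r T := by
  obtain ⟨h₀, h₁, h₂, h₃⟩ := hammingWt_pairEquivVec T W
  have hT := card_inter_add_card_sdiff T W
  have hunion := card_sdiff_add_card W T
  have hcompl := card_compl_add_card (T ∪ W)
  rw [Fintype.card_fin] at hcompl
  rw [inter_comm] at hT
  rw [union_comm] at hunion
  rw [vectorsOfType, Set.mem_ofPred_eq, h₀, h₁, h₂, h₃, mem_powersetCard_univ, mem_splitSets]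
  omega

open Classical in
/-- The connection set of `cayleyZ4 n r s`, as a finset. -/
noncomputable def connectionSet (n r s : ℕ) : Finset (Fin n → ZMod 4) :=
  {v | v ∈ vectorsOfType n r s r s}

theorem mem_connectionSet {n r s : ℕ} {v : Fin n → ZMod 4} :
    v ∈ connectionSet n r s ↔ v ∈ vectorsOfType n r s r s := by
  simp [connectionSet]

variable {n r s : ℕ}

theorem sum_connectionSet {M : Type*} [AddCommMonoid M] (hn : n = 2 * (r + s))
    (f : (Fin n → ZMod 4) → M) :
    ∑ v ∈ connectionSet n r s, f v
      = ∑ T ∈ powersetCard (2 * s) univ, ∑ W ∈ splitSets s r T,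
        f (pairEquivVec (Fin n) (T, W)) := by
  rw [← sum_finset_product ((connectionSet n r s).map (pairEquivVec (Fin n)).symm.toEmbedding) _ _
    (fun p => by rw [mem_map_equiv, Equiv.symm_symm, mem_connectionSet,
      ← pairEquivVec_mem_vectorsOfType hn])
    (f := fun p => f (pairEquivVec (Fin n) p)), sum_map]
  simp only [Equiv.coe_toEmbedding, Equiv.apply_symm_apply]

theorem card_connectionSet_eq_sum (hn : n = 2 * (r + s)) :
    #(connectionSet n r s)
      = ∑ T ∈ powersetCard (2 * s) (univ : Finset (Fin n)), #(splitSets s r T) := by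
  simp only [card_eq_sum_ones, sum_connectionSet hn]

theorem card_connectionSet (hn : n = 2 * (r + s)) :
    #(connectionSet n r s) = n.choose (2 * s) * ((2 * s).choose s * (2 * r).choose r) := by
  have hsplit : ∀ T ∈ powersetCard (2 * s) (univ : Finset (Fin n)),
      #(splitSets s r T) = (2 * s).choose s * (2 * r).choose r := fun T hT => by
    rw [card_splitSets, card_compl, mem_powersetCard_univ.1 hT, Fintype.card_fin, hn,
      ← Nat.mul_sub, Nat.add_sub_cancel]
  rw [card_connectionSet_eq_sum hn, sum_congr rfl hsplit, sum_const, card_powersetCard, card_fin,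
    smul_eq_mul]

theorem card_connectionSet_eq_middle (hn : n = 2 * (r + s)) :
    (#(connectionSet n r s) : ℤ) = (r + s).choose s ^ 2 * n.choose (r + s) := by
  have h := sum_sum_splitSets_prod (ι := Fin n) (by rwa [Fintype.card_fin]) (fun _ => 1)
  rw [card_connectionSet_eq_sum hn]
  simpa [krawtchouk_zero_right, ← hn] using h

theorem exists_units_eq_mul_of_sq_eq_sq {R : Type*} [CommRing R] [NoZeroDivisors R] {x y : R}
    (h : x ^ 2 = y ^ 2) : ∃ δ : ℤˣ, x = (δ : ℤ) * y := by
  rcases sq_eq_sq_iff_eq_or_eq_neg.1 h with h | h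
  · exact ⟨1, by simpa using h⟩
  · exact ⟨-1, by simpa using h⟩

theorem addChar_pairEquivVec {ι M : Type*} [Fintype ι] [DecidableEq ι] [CommMonoid M]
    (ψ : AddChar (ι → ZMod 4) M) (T W : Finset ι) :
    ψ (pairEquivVec ι (T, W))
      = (∏ j ∈ T, ψ (Pi.single j 1)) * ∏ j ∈ W, ψ (Pi.single j 1) ^ 2 := by
  have h : pairEquivVec ι (T, W)
      = ∑ j ∈ T, Pi.single j (1 : ZMod 4) + ∑ j ∈ W, 2 • Pi.single j (1 : ZMod 4) := by
    ext j
    simp [pairEquivVec, Finset.sum_apply, Pi.single_apply]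
  have hsum (A : Finset ι) (f : ι → ι → ZMod 4) : ψ (∑ j ∈ A, f j) = ∏ j ∈ A, ψ (f j) :=
    map_prod ψ.toMonoidHom (fun j => Multiplicative.ofAdd (f j)) A
  rw [h, AddChar.map_add_eq_mul, hsum, hsum]
  simp only [AddChar.map_nsmul_eq_pow]

theorem addChar_single_one_pow_four {ι M : Type*} [DecidableEq ι] [CommMonoid M]
    (ψ : AddChar (ι → ZMod 4) M) (j : ι) : ψ (Pi.single j 1) ^ 4 = 1 := by
  rw [← AddChar.map_nsmul_eq_pow, ← Pi.single_smul, show (4 : ℕ) • (1 : ZMod 4) = 0 by decide,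
    Pi.single_zero, AddChar.map_zero_eq_one]

theorem sum_connectionSet_addChar (hn : n = 2 * (r + s)) {R : Type*} [CommRing R]
    (ψ : AddChar (Fin n → ZMod 4) R) {ε : Fin n → ℤˣ}
    (hε : ∀ j, ψ (Pi.single j 1) ^ 2 = (ε j : ℤ)) :
    ∑ v ∈ connectionSet n r s, ψ v = ∑ T ∈ powersetCard (2 * s) univ,
      (∏ j ∈ T, ψ (Pi.single j 1)) * ((∑ W ∈ splitSets s r T, ∏ j ∈ W, (ε j : ℤ) : ℤ) : R) := by
  simp only [sum_connectionSet hn, addChar_pairEquivVec, hε, mul_sum, Int.cast_sum, Int.cast_prod]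

theorem norm_sum_connectionSet_addChar_le (hn : n = 2 * (r + s))
    (ψ : AddChar (Fin n → ZMod 4) ℂ) {ε : Fin n → ℤˣ}
    (hε : ∀ j, ψ (Pi.single j 1) ^ 2 = (ε j : ℤ)) :
    ‖∑ v ∈ connectionSet n r s, ψ v‖
      ≤ (((r + s).choose s ^ 2 * |krawtchouk n (r + s) #{j | ε j = -1}| : ℤ) : ℝ) := by
  have hι : Fintype.card (Fin n) = 2 * (r + s) := by rwa [Fintype.card_fin]
  set σ : ℤ := (-1) ^ (#{j | ε j = -1} / 2)
  have hσ : |σ| = 1 := abs_neg_one_pow _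
  rw [sum_connectionSet_addChar hn ψ hε]
  calc
    _ ≤ ∑ T ∈ powersetCard (2 * s) (univ : Finset (Fin n)),
        ((σ * ∑ W ∈ splitSets s r T, ∏ j ∈ W, (ε j : ℤ) : ℤ) : ℝ) := by
      refine norm_sum_le_of_le _ fun T hT => ?_
      have hsign := neg_one_pow_mul_sum_splitSets_prod_nonneg hι (mem_powersetCard_univ.1 hT) ε
      rw [norm_mul, norm_prod, prod_eq_one fun j _ => AddChar.norm_apply ψ _, one_mul,
        Complex.norm_intCast, ← Int.cast_abs, ← abs_of_nonneg hsign, abs_mul, hσ, one_mul]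
    _ = ((σ * ((r + s).choose s ^ 2 * krawtchouk n (r + s) #{j | ε j = -1}) : ℤ) : ℝ) := by
      rw [← Int.cast_sum, ← mul_sum, sum_sum_splitSets_prod hι, ← hn]
    _ ≤ _ := by
      refine Int.cast_le.2 ((le_abs_self _).trans_eq ?_)
      rw [abs_mul, abs_mul, hσ, one_mul, abs_pow, Nat.abs_cast]

theorem neg_card_connectionSet_le_of_mixed (hn : n = 2 * (r + s))
    (ψ : AddChar (Fin n → ZMod 4) ℂ) {ε : Fin n → ℤˣ}
    (hε : ∀ j, ψ (Pi.single j 1) ^ 2 = (ε j : ℤ)) (h₀ : 0 < #{j | ε j = -1})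
    (h₁ : #{j | ε j = -1} < n) :
    -(#(connectionSet n r s) : ℝ) ≤ (n - 1) * (∑ v ∈ connectionSet n r s, ψ v).re := by
  have hmiddle := two_mul_sub_one_mul_abs_krawtchouk_middle_le h₀ (h₁.trans_eq hn)
  have hcard : (n - 1 : ℤ) * ((r + s).choose s ^ 2 * |krawtchouk n (r + s) #{j | ε j = -1}|)
      ≤ #(connectionSet n r s) := by
    rw [card_connectionSet_eq_middle hn, mul_left_comm]
    refine mul_le_mul_of_nonneg_left ?_ (by positivity)
    rwa [← hn, show 2 * ((r + s : ℕ) : ℤ) = n by exact_mod_cast hn.symm] at hmiddle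
  have hcard : (n - 1 : ℝ) *
      (((r + s).choose s ^ 2 * |krawtchouk n (r + s) #{j | ε j = -1}| : ℤ) : ℝ)
        ≤ #(connectionSet n r s) := by exact_mod_cast hcard
  have hn₁ : (0 : ℝ) ≤ n - 1 := sub_nonneg.2 (by exact_mod_cast h₀.trans h₁)
  have hre := (abs_le.1 ((Complex.abs_re_le_norm _).trans
    (norm_sum_connectionSet_addChar_le hn ψ hε))).1
  have := mul_le_mul_of_nonneg_left hre hn₁
  linarith

/-- For even `r`, the factor `ω ^ (2 * s) * e ^ (r + s)` with `ω ^ 2 = e` is `1`. -/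
theorem exists_sum_connectionSet_addChar_eq_krawtchouk (hn : n = 2 * (r + s)) (hr : Even r)
    (ψ : AddChar (Fin n → ZMod 4) ℂ) {e : ℤˣ} (he : ∀ j, ψ (Pi.single j 1) ^ 2 = (e : ℤ)) :
    ∃ k ≤ n, ∑ v ∈ connectionSet n r s, ψ v
      = (((2 * s).choose s * (2 * r).choose r * krawtchouk n (2 * s) k : ℤ) : ℂ) := by
  obtain ⟨ω, hω⟩ := IsAlgClosed.exists_pow_nat_eq ((e : ℤ) : ℂ) two_pos
  choose δ hδ using fun j => exists_units_eq_mul_of_sq_eq_sq ((he j).trans hω.symm)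
  have hsplit : ∀ T ∈ powersetCard (2 * s) (univ : Finset (Fin n)),
      (∏ j ∈ T, ψ (Pi.single j 1)) * ((∑ W ∈ splitSets s r T, ∏ _j ∈ W, (e : ℤ) : ℤ) : ℂ)
        = (((2 * s).choose s * (2 * r).choose r * ∏ j ∈ T, (δ j : ℤ) : ℤ) : ℂ) := fun T hT => by
    have hT := mem_powersetCard_univ.1 hT
    have hTc : #Tᶜ = 2 * r := by rw [card_compl, Fintype.card_fin]; omega
    have hsign : ((e : ℤ) : ℂ) ^ s * ((e : ℤ) : ℂ) ^ (s + r) = 1 := by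
      rw [← pow_add, ← add_assoc, ← two_mul]
      rcases Int.units_eq_one_or e with rfl | rfl
      · simp
      · simp [((even_two_mul s).add hr).neg_one_pow]
    have hprod : ∀ W ∈ splitSets s r T, ∏ _j ∈ W, (e : ℤ) = (e : ℤ) ^ (s + r) := fun W hW => by
      rw [prod_const, card_of_mem_splitSets hW]
    rw [sum_congr rfl hprod, sum_const, card_splitSets, hT, hTc, prod_congr rfl fun j _ => hδ j,
      prod_mul_distrib, prod_const, hT, pow_mul, hω, nsmul_eq_mul]
    push_cast
    linear_combination
      (((2 * s).choose s : ℂ) * (2 * r).choose r * ∏ j ∈ T, ((δ j : ℤ) : ℂ)) * hsign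
  refine ⟨#{j | δ j = -1}, by simpa using card_filter_le univ fun j => δ j = -1, ?_⟩
  rw [sum_connectionSet_addChar hn ψ he, sum_congr rfl hsplit, ← Int.cast_sum, ← mul_sum,
    sum_powersetCard_prod, card_fin]

theorem neg_card_connectionSet_le (hn : n = 2 * (r + s)) (hr : Even r)
    (hkrawtchouk : ∀ k ≤ n, -(n.choose (2 * s) : ℤ) ≤ (n - 1) * krawtchouk n (2 * s) k)
    (ψ : AddChar (Fin n → ZMod 4) ℂ) :
    -(#(connectionSet n r s) : ℝ) ≤ (n - 1) * (∑ v ∈ connectionSet n r s, ψ v).re := by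
  have hfourth (j : Fin n) : (ψ (Pi.single j 1) ^ 2) ^ 2 = (1 : ℂ) ^ 2 := by
    rw [← pow_mul, addChar_single_one_pow_four, one_pow]
  choose ε hε using fun j => exists_units_eq_mul_of_sq_eq_sq (hfourth j)
  simp only [mul_one] at hε
  by_cases hmixed : 0 < #{j | ε j = -1} ∧ #{j | ε j = -1} < n
  · exact neg_card_connectionSet_le_of_mixed hn ψ hε hmixed.1 hmixed.2
  obtain ⟨e, he⟩ : ∃ e, ∀ j, ε j = e := by
    by_cases h₀ : 0 < #{j | ε j = -1}
    · have hall : #{j | ε j = -1} = #(univ : Finset (Fin n)) :=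
        le_antisymm (card_filter_le _ _) (by rw [card_fin]; omega)
      exact ⟨-1, fun j => card_filter_eq_iff.1 hall j (mem_univ j)⟩
    · refine ⟨1, fun j => (Int.units_eq_one_or _).resolve_right fun hj => h₀ ?_⟩
      exact card_pos.2 ⟨j, by simpa using hj⟩
  obtain ⟨k, hk, hsum⟩ := exists_sum_connectionSet_addChar_eq_krawtchouk hn hr ψ
    fun j => (hε j).trans (by rw [he j])
  have hbound : -(#(connectionSet n r s) : ℤ)
      ≤ (n - 1) * ((2 * s).choose s * (2 * r).choose r * krawtchouk n (2 * s) k) := by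
    have := mul_le_mul_of_nonneg_left (hkrawtchouk k hk)
      (Nat.cast_nonneg' (α := ℤ) ((2 * s).choose s * (2 * r).choose r))
    rw [card_connectionSet hn]
    push_cast at this ⊢
    linarith
  rw [hsum, Complex.intCast_re]
  exact_mod_cast hbound

end CharacterSums

section SpectralWeight

open Finset

variable {G H ι : Type*} [AddCommGroup G] [Fintype G] [SeminormedAddCommGroup H]
  [InnerProductSpace ℂ H] [Fintype ι]

/-- The (unnormalized) Fourier coefficient at `ψ` of a vector-valued function on `G`. -/
noncomputable def fourierCoefficient (f : G → H) (ψ : AddChar G ℂ) : H := ∑ v, ψ v • f v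

/-- For `S = {0}` this is Parseval's identity. -/
theorem sum_mul_norm_fourierCoefficient_sq (S : Finset G) (f : G → H) :
    ∑ ψ : AddChar G ℂ, (∑ u ∈ S, ψ u) * (‖fourierCoefficient f ψ‖ : ℂ) ^ 2
      = Fintype.card G * ∑ u ∈ S, ∑ v, inner ℂ (f (v + u)) (f v) := by
  classical
  have hexpand (ψ : AddChar G ℂ) :
      (∑ u ∈ S, ψ u) * (‖fourierCoefficient f ψ‖ : ℂ) ^ 2
        = ∑ u ∈ S, ∑ v, ∑ w, ψ (v + u - w) * inner ℂ (f w) (f v) := by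
    rw [← Complex.coe_algebraMap, ← inner_self_eq_norm_sq_to_K (𝕜 := ℂ), fourierCoefficient,
      inner_sum, sum_mul_sum]
    refine sum_congr rfl fun u _ => sum_congr rfl fun v _ => ?_
    rw [sum_inner, mul_sum]
    refine sum_congr rfl fun w _ => ?_
    rw [inner_smul_left, inner_smul_right, sub_eq_add_neg, AddChar.map_add_eq_mul,
      AddChar.map_add_eq_mul, AddChar.map_neg_eq_conj]
    ring
  have horthogonality (u v : G) : ∑ ψ : AddChar G ℂ, ∑ w, ψ (v + u - w) * inner ℂ (f w) (f v)
      = Fintype.card G * inner ℂ (f (v + u)) (f v) := by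
    simp only [sum_comm (s := (univ : Finset (AddChar G ℂ))), ← sum_mul,
      AddChar.sum_apply_eq_ite, sub_eq_zero, ite_mul, zero_mul, sum_ite_eq, mem_univ, if_true]
  simp only [hexpand, mul_sum, ← horthogonality]
  rw [sum_comm]
  exact sum_congr rfl fun u _ => sum_comm

/-- The weight of the character `ψ` in a family of vector-valued functions on `G`. -/
noncomputable def spectralWeight (x : G → ι → H) (ψ : AddChar G ℂ) : ℝ :=
  ∑ i, ‖fourierCoefficient (x · i) ψ‖ ^ 2

variable {x : G → ι → H} {e : H} {S : Finset G}

theorem spectralWeight_nonneg (x : G → ι → H) (ψ : AddChar G ℂ) : 0 ≤ spectralWeight x ψ :=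
  sum_nonneg fun _ _ => sq_nonneg _

theorem sum_mul_spectralWeight (S : Finset G) (x : G → ι → H) :
    ∑ ψ : AddChar G ℂ, (∑ u ∈ S, ψ u) * (spectralWeight x ψ : ℂ)
      = Fintype.card G * ∑ i, ∑ u ∈ S, ∑ v, inner ℂ (x (v + u) i) (x v i) := by
  rw [mul_sum, ← sum_congr rfl fun i _ => sum_mul_norm_fourierCoefficient_sq S (x · i), sum_comm]
  simp only [spectralWeight, Complex.ofReal_sum, Complex.ofReal_pow, mul_sum]

theorem sum_re_mul_spectralWeight_eq_zero
    (horth : ∀ u ∈ S, ∀ v i, inner ℂ (x (v + u) i) (x v i) = 0) :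
    ∑ ψ : AddChar G ℂ, (∑ u ∈ S, ψ u).re * spectralWeight x ψ = 0 := by
  have h := congrArg Complex.re (sum_mul_spectralWeight S x)
  have hzero : ∑ i, ∑ u ∈ S, ∑ v, inner ℂ (x (v + u) i) (x v i) = 0 :=
    sum_eq_zero fun i _ => sum_eq_zero fun u hu => sum_eq_zero fun v _ => horth u hu v i
  rw [hzero, mul_zero, Complex.re_sum, Complex.zero_re] at h
  simpa only [Complex.re_mul_ofReal] using h

theorem sum_spectralWeight (hnorm : ∀ v, ∑ i, ‖x v i‖ ^ 2 = ‖e‖ ^ 2) :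
    ∑ ψ : AddChar G ℂ, spectralWeight x ψ = Fintype.card G ^ 2 * ‖e‖ ^ 2 := by
  have h := sum_mul_spectralWeight {0} x
  have hinner (v : G) : ∑ i, inner ℂ (x v i) (x v i) = ((‖e‖ ^ 2 : ℝ) : ℂ) := by
    rw [← hnorm v, Complex.ofReal_sum]
    exact sum_congr rfl fun i _ => by rw [inner_self_eq_norm_sq_to_K, Complex.ofReal_pow]; rfl
  simp only [sum_singleton, AddChar.map_zero_eq_one, one_mul, add_zero] at h
  rw [sum_comm, sum_congr rfl fun v _ => hinner v, sum_const, card_univ, nsmul_eq_mul, ← mul_assoc,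
    ← sq] at h
  exact_mod_cast h

theorem card_sq_mul_norm_sq_le_mul_spectralWeight_zero (hsum : ∀ v, ∑ i, x v i = e) :
    Fintype.card G ^ 2 * ‖e‖ ^ 2 ≤ Fintype.card ι * spectralWeight x 0 := by
  have htotal : ∑ i, fourierCoefficient (x · i) 0 = Fintype.card G • e := by
    simp only [fourierCoefficient, AddChar.zero_apply, one_smul]
    rw [sum_comm, sum_congr rfl fun v _ => hsum v, sum_const, card_univ]
  calc
    (Fintype.card G ^ 2 * ‖e‖ ^ 2 : ℝ) = ‖∑ i, fourierCoefficient (x · i) 0‖ ^ 2 := by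
      rw [htotal, ← Nat.cast_smul_eq_nsmul ℝ, norm_smul, mul_pow,
        Real.norm_natCast]
    _ ≤ (∑ i, ‖fourierCoefficient (x · i) 0‖) ^ 2 := by gcongr; exact norm_sum_le _ _
    _ ≤ Fintype.card ι * spectralWeight x 0 := sq_sum_le_card_mul_sum_sq

theorem mul_spectralWeight_zero_le {θ : ℝ} (hS : S.Nonempty)
    (hθ : ∀ ψ : AddChar G ℂ, -(#S : ℝ) ≤ (θ - 1) * (∑ u ∈ S, ψ u).re)
    (horth : ∀ u ∈ S, ∀ v i, inner ℂ (x (v + u) i) (x v i) = 0) :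
    θ * spectralWeight x 0 ≤ ∑ ψ : AddChar G ℂ, spectralWeight x ψ := by
  classical
  have hnonneg (ψ : AddChar G ℂ) : 0 ≤ (#S + (θ - 1) * (∑ u ∈ S, ψ u).re) * spectralWeight x ψ :=
    mul_nonneg (by linarith [hθ ψ]) (spectralWeight_nonneg x ψ)
  have hzero : ((∑ u ∈ S, (0 : AddChar G ℂ) u).re : ℝ) = #S := by simp
  refine le_of_mul_le_mul_left ?_ (Nat.cast_pos (α := ℝ).2 hS.card_pos)
  calc
    #S * (θ * spectralWeight x 0)
      = (#S + (θ - 1) * (∑ u ∈ S, (0 : AddChar G ℂ) u).re) * spectralWeight x 0 := by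
        rw [hzero]; ring
    _ ≤ ∑ ψ : AddChar G ℂ, (#S + (θ - 1) * (∑ u ∈ S, ψ u).re) * spectralWeight x ψ :=
      single_le_sum (fun ψ _ => hnonneg ψ) (mem_univ (0 : AddChar G ℂ))
    _ = #S * ∑ ψ : AddChar G ℂ, spectralWeight x ψ := by
      simp only [add_mul, sum_add_distrib, mul_assoc, ← mul_sum]
      rw [sum_re_mul_spectralWeight_eq_zero horth, mul_zero, add_zero]

end SpectralWeight

section HoffmanBound

open Finset
open scoped ComplexOrder

variable {G : Type*} [AddCommGroup G] [Finite G] {S : Finset G} {θ : ℝ}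

theorem le_card_of_orthogonal {H ι : Type*} [SeminormedAddCommGroup H] [InnerProductSpace ℂ H]
    [Fintype ι] {x : G → ι → H} {e : H} (hS : S.Nonempty)
    (hθ : ∀ ψ : AddChar G ℂ, -(#S : ℝ) ≤ (θ - 1) * (∑ u ∈ S, ψ u).re)
    (he : ‖e‖ ≠ 0) (hsum : ∀ v, ∑ i, x v i = e) (hnorm : ∀ v, ∑ i, ‖x v i‖ ^ 2 = ‖e‖ ^ 2)
    (horth : ∀ u ∈ S, ∀ v i, inner ℂ (x (v + u) i) (x v i) = 0) :
    θ ≤ Fintype.card ι := by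
  cases nonempty_fintype G
  rcases le_total θ 0 with hθ₀ | hθ₀
  · exact hθ₀.trans (Nat.cast_nonneg _)
  have htotal := sum_spectralWeight hnorm
  have hpos : (0 : ℝ) < Fintype.card G ^ 2 * ‖e‖ ^ 2 := by
    have : 0 < Fintype.card G := Fintype.card_pos
    positivity
  refine le_of_mul_le_mul_right ?_ hpos
  calc
    θ * (Fintype.card G ^ 2 * ‖e‖ ^ 2)
      ≤ θ * (Fintype.card ι * spectralWeight x 0) :=
        mul_le_mul_of_nonneg_left (card_sq_mul_norm_sq_le_mul_spectralWeight_zero hsum) hθ₀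
    _ = Fintype.card ι * (θ * spectralWeight x 0) := mul_left_comm ..
    _ ≤ Fintype.card ι * (Fintype.card G ^ 2 * ‖e‖ ^ 2) := by
      rw [← htotal]
      exact mul_le_mul_of_nonneg_left (mul_spectralWeight_zero_le hS hθ horth) (Nat.cast_nonneg _)

theorem QuantumColoring.le_of_hoffman {Γ : SimpleGraph G} {c d : ℕ} (Q : QuantumColoring Γ c d)
    (hS : S.Nonempty) (hadj : ∀ v, ∀ u ∈ S, Γ.Adj v (v + u))
    (hθ : ∀ ψ : AddChar G ℂ, -(#S : ℝ) ≤ (θ - 1) * (∑ u ∈ S, ψ u).re) : θ ≤ c := by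
  have hone : (1 : Matrix (Fin d) (Fin d) ℂ).PosSemidef := .one
  let := Matrix.toMatrixSeminormedAddCommGroup 1 hone
  let := Matrix.toMatrixInnerProductSpace 1 hone
  have hinner (A B : Matrix (Fin d) (Fin d) ℂ) : inner ℂ A B = (B * A.conjTranspose).trace := by
    change (B * 1 * A.conjTranspose).trace = _
    rw [mul_one]
  have hnorm (A : Matrix (Fin d) (Fin d) ℂ) (hA : IsStarProjection A) :
      ‖A‖ ^ 2 = A.trace.re := by
    rw [← inner_self_eq_norm_sq (𝕜 := ℂ), hinner, ← Matrix.star_eq_conjTranspose,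
      hA.isSelfAdjoint.star_eq, hA.isIdempotentElem.eq]
    rfl
  rw [← Fintype.card_fin c]
  refine le_card_of_orthogonal (x := Q.P) (e := 1) hS hθ ?_ Q.sum_eq_one (fun v => ?_) ?_
  · rw [← sq_eq_zero_iff.ne, hnorm 1 (.one _)]
    simp [Q.dim_pos.ne']
  · rw [hnorm 1 (.one _), ← Q.sum_eq_one v, Matrix.trace_sum, Complex.re_sum]
    exact sum_congr rfl fun i _ => hnorm _ (Q.isStarProjection v i)
  · intro u hu v i
    rw [hinner, ← Matrix.star_eq_conjTranspose, (Q.isStarProjection _ i).isSelfAdjoint.star_eq,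
      Q.mul_eq_zero v (v + u) (hadj v u hu), Matrix.trace_zero]

end HoffmanBound

section OrthogonalRepresentations

open Finset Matrix ComplexConjugate

variable {V : Type*} {Γ : SimpleGraph V} {n : ℕ}

theorem quantumColorable_of_unitary (hn : 0 < n) {U : V → Matrix (Fin n) (Fin n) ℂ}
    (hU : ∀ v, U v ∈ unitaryGroup (Fin n) ℂ)
    (horth : ∀ v w, Γ.Adj v w → ∀ i, (star (U v) * U w) i i = 0) : QuantumColorable Γ n := by
  refine ⟨n, ⟨⟨hn, fun v i => U v * single i i 1 * star (U v), fun v i => ⟨?_, ?_⟩, fun v => ?_,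
    fun v w hvw i => ?_⟩⟩⟩
  · calc
      U v * single i i 1 * star (U v) * (U v * single i i 1 * star (U v))
        = U v * (single i i 1 * (star (U v) * U v) * single i i 1) * star (U v) := by
          simp only [mul_assoc]
      _ = U v * single i i 1 * star (U v) := by
        rw [mem_unitaryGroup_iff'.1 (hU v), mul_one, single_mul_single_same, one_mul]
  · rw [IsSelfAdjoint, star_mul, star_mul, star_star, star_eq_conjTranspose (single i i 1),
      conjTranspose_single, star_one, mul_assoc]
  · rw [← sum_mul, ← mul_sum, sum_single_one, mul_one, mem_unitaryGroup_iff.1 (hU v)]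
  · calc
      U v * single i i 1 * star (U v) * (U w * single i i 1 * star (U w))
        = U v * (single i i 1 * (star (U v) * U w) * single i i 1) * star (U w) := by
          simp only [mul_assoc]
      _ = 0 := by
        rw [single_mul_mul_single, horth v w hvw, mul_zero, zero_mul, single_zero, mul_zero,
          zero_mul]

theorem exists_flat_unitary (n : ℕ) [NeZero n] :
    ∃ F ∈ unitaryGroup (Fin n) ℂ, ∀ a i, conj (F a i) * F a i = (n : ℂ)⁻¹ := by
  let e := (ZMod.finEquiv n).toEquiv
  let F : Matrix (Fin n) (Fin n) ℂ := of fun a i => (√n : ℂ)⁻¹ * ZMod.stdAddChar (e i * e a)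
  have hsqrt : ((√n : ℝ) : ℂ)⁻¹ * ((√n : ℝ) : ℂ)⁻¹ = (n : ℂ)⁻¹ := by
    rw [← mul_inv, ← Complex.ofReal_mul, Real.mul_self_sqrt n.cast_nonneg, Complex.ofReal_natCast]
  have hprod (a b i : Fin n) :
      F a i * conj (F b i) = (n : ℂ)⁻¹ * ZMod.stdAddChar (e i * (e a - e b)) := by
    simp only [F, of_apply, map_mul, map_inv₀, Complex.conj_ofReal, ← AddChar.map_neg_eq_conj]
    rw [mul_mul_mul_comm, hsqrt, ← AddChar.map_add_eq_mul, mul_sub, sub_eq_add_neg]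
  refine ⟨F, mem_unitaryGroup_iff.2 ?_, fun a i => ?_⟩
  · ext a b
    simp only [mul_apply, star_apply, ← starRingEnd_apply, hprod, ← mul_sum]
    rw [e.sum_comp fun x => ZMod.stdAddChar (x * (e a - e b)),
      AddChar.sum_mulShift _ (ZMod.isPrimitive_stdAddChar n), one_apply]
    simp [sub_eq_zero, NeZero.ne]
  · rw [mul_comm]
    exact (hprod a a i).trans (by simp)

theorem quantumColorable_of_orthogonal (hn : 0 < n) (f : V → Fin n → Circle)
    (hf : ∀ v w, Γ.Adj v w → ∑ a, conj (f v a : ℂ) * f w a = 0) : QuantumColorable Γ n := by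
  have : NeZero n := ⟨hn.ne'⟩
  obtain ⟨F, hF, hflat⟩ := exists_flat_unitary n
  have hdiagonal (v : V) : diagonal (fun a => (f v a : ℂ)) ∈ unitaryGroup (Fin n) ℂ := by
    rw [mem_unitaryGroup_iff, star_eq_conjTranspose, diagonal_conjTranspose, diagonal_mul_diagonal,
      ← diagonal_one]
    congr 1
    ext a
    exact (Complex.mul_conj' _).trans (by rw [Circle.norm_coe, Complex.ofReal_one, one_pow])
  refine quantumColorable_of_unitary hn (fun v => mul_mem (hdiagonal v) hF) fun v w hvw i => ?_
  rw [mul_apply]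
  simp only [star_apply, diagonal_mul, ← starRingEnd_apply, map_mul]
  calc
    ∑ a, conj (f v a : ℂ) * conj (F a i) * (f w a * F a i)
      = ∑ a, conj (f v a : ℂ) * f w a * (n : ℂ)⁻¹ :=
        sum_congr rfl fun a _ => by rw [← hflat a i]; ring
    _ = 0 := by rw [← sum_mul, hf v w hvw, zero_mul]

end OrthogonalRepresentations

section CayleyColoring

open Finset ComplexConjugate ZMod

theorem stdAddChar_four_add_two (k : ZMod 4) : stdAddChar (k + 2) = -stdAddChar k := by
  have hsq : stdAddChar (2 : ZMod 4) ^ 2 = 1 := by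
    rw [← AddChar.map_nsmul_eq_pow, show 2 • (2 : ZMod 4) = 0 by decide, AddChar.map_zero_eq_one]
  have hne : stdAddChar (2 : ZMod 4) ≠ 1 := by
    rw [← AddChar.map_zero_eq_one (stdAddChar (N := 4)), injective_stdAddChar.ne_iff]
    decide
  rw [AddChar.map_add_eq_mul, (sq_eq_one_iff.1 hsq).resolve_left hne, mul_neg_one]

variable {n r s : ℕ}

theorem sum_stdAddChar_eq_zero {v : Fin n → ZMod 4} (hv : v ∈ vectorsOfType n r s r s) :
    ∑ a, stdAddChar (v a) = 0 := by
  obtain ⟨h0, h1, h2, h3⟩ := hv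
  calc
    ∑ a, stdAddChar (v a) = ∑ k : ZMod 4, hammingWt k v • stdAddChar k := by
      rw [← sum_fiberwise univ v]
      exact sum_congr rfl fun k _ => sum_eq_card_nsmul fun a ha => by rw [(mem_filter.1 ha).2]
    _ = r • (stdAddChar (0 : ZMod 4) + stdAddChar (0 + 2 : ZMod 4))
        + s • (stdAddChar (1 : ZMod 4) + stdAddChar (1 + 2 : ZMod 4)) := by
      change ∑ k : Fin 4, hammingWt (n := n) (k : ZMod 4) v • stdAddChar (N := 4) k = _
      rw [Fin.sum_univ_four]
      change hammingWt 0 v • stdAddChar (0 : ZMod 4) + hammingWt 1 v • stdAddChar (1 : ZMod 4)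
        + hammingWt 2 v • stdAddChar (0 + 2 : ZMod 4)
        + hammingWt 3 v • stdAddChar (1 + 2 : ZMod 4) = _
      rw [h0, h1, h2, h3, nsmul_add, nsmul_add]
      abel
    _ = 0 := by simp only [stdAddChar_four_add_two, add_neg_cancel, smul_zero, add_zero]

theorem quantumColorable_cayleyZ4 (r s : ℕ) (hn : 0 < n) :
    QuantumColorable (cayleyZ4 n r s) n := by
  refine quantumColorable_of_orthogonal hn (fun v a => toCircle (v a)) fun v w hvw => ?_
  simp only [← stdAddChar_apply, ← AddChar.map_neg_eq_conj, ← AddChar.map_add_eq_mul]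
  rw [cayleyZ4, SimpleGraph.addCayley_adj'] at hvw
  obtain ⟨-, g, hg, rfl | rfl⟩ := hvw
  · simpa only [Pi.add_apply, neg_add_cancel_left] using sum_stdAddChar_eq_zero hg
  · have h := congrArg conj (sum_stdAddChar_eq_zero hg)
    simpa only [map_sum, ← AddChar.map_neg_eq_conj, map_zero, Pi.add_apply, neg_add_rev,
      neg_add_cancel_right] using h

end CayleyColoring

section QuantumChromaticNumber

variable {n r s : ℕ}

theorem connectionSet_nonempty (hn : n = 2 * (r + s)) : (connectionSet n r s).Nonempty := by
  rw [← Finset.card_pos, card_connectionSet hn]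
  have h₁ := Nat.choose_pos (show 2 * s ≤ n by lia)
  have h₂ := Nat.choose_pos (show s ≤ 2 * s by lia)
  have h₃ := Nat.choose_pos (show r ≤ 2 * r by lia)
  positivity

theorem zero_notMem_vectorsOfType (hn : n = 2 * (r + s)) (hn₀ : 0 < n) :
    0 ∉ vectorsOfType n r s r s := by
  rintro ⟨h₀, -⟩
  simp only [hammingWt, Pi.zero_apply, Finset.filter_true, Finset.card_fin] at h₀
  lia

theorem cayleyZ4_adj_add (hn : n = 2 * (r + s)) (hn₀ : 0 < n) (v : Fin n → ZMod 4)
    {u : Fin n → ZMod 4} (hu : u ∈ connectionSet n r s) : (cayleyZ4 n r s).Adj v (v + u) := by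
  rw [mem_connectionSet] at hu
  rw [cayleyZ4, SimpleGraph.addCayley_adj']
  refine ⟨fun h => zero_notMem_vectorsOfType hn hn₀ ?_, u, hu, Or.inl rfl⟩
  rwa [left_eq_add.1 h] at hu

theorem quantumChromaticNumber_cayleyZ4 (hn : n = 2 * (r + s)) (hn₀ : 0 < n) (hr : Even r)
    (hkrawtchouk : ∀ k ≤ n, -(n.choose (2 * s) : ℤ) ≤ (n - 1) * krawtchouk n (2 * s) k) :
    quantumChromaticNumber (cayleyZ4 n r s) = n := by
  apply le_antisymm
  · exact iInf_le (fun c : {c // QuantumColorable (cayleyZ4 n r s) c} => ((c : ℕ) : ℕ∞))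
      ⟨n, quantumColorable_cayleyZ4 r s hn₀⟩
  · refine le_iInf fun ⟨c, d, ⟨Q⟩⟩ => Nat.cast_le.2 ?_
    have hoffman := Q.le_of_hoffman (connectionSet_nonempty hn)
      (fun v u hu => cayleyZ4_adj_add hn hn₀ v hu) (neg_card_connectionSet_le hn hr hkrawtchouk)
    exact_mod_cast hoffman

theorem mainTheorem2_general :
    ∃ N : ℕ, ∀ n r s : ℕ, n = 2 * (r + s) → Even r → (s : ℝ) ≤ 0.17 * (n / 2) → N ≤ n →
      quantumChromaticNumber (cayleyZ4 n r s) = n := by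
  obtain ⟨N, hN⟩ := Filter.eventually_atTop.1
    (eventually_neg_choose_le_mul_krawtchouk.and (Filter.eventually_gt_atTop 0))
  refine ⟨N, fun n r s hn hr hs hNn => ?_⟩
  obtain ⟨hkrawtchouk, hn₀⟩ := hN n hNn
  refine quantumChromaticNumber_cayleyZ4 hn hn₀ hr fun k hk =>
    hkrawtchouk (2 * s) k (even_two_mul s) ?_ hk
  push_cast
  linarith

end QuantumChromaticNumber

theorem mainTheorem2 :
    (∀ s : ℕ, 2 ≤ s → ∃ N : ℕ, ∀ n r : ℕ, n = 2 * (r + s) → s ≤ r → Even r → N ≤ n →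
      quantumChromaticNumber (cayleyZ4 n r s) = n) ∧
    (∃ N : ℕ, ∀ α : ℝ, 0 < α → α ≤ 0.17 →
      ∀ n r s : ℕ, n = 2 * (r + s) → s ≤ r → Even r → (s : ℝ) = α * ((n : ℝ) / 2) → N ≤ n →
        quantumChromaticNumber (cayleyZ4 n r s) = n) := by
  obtain ⟨N, hN⟩ := mainTheorem2_general
  refine ⟨fun s _ => ⟨max N (12 * s), fun n r hn _ hr hNn => hN n r s hn hr ?_ ?_⟩,
    N, fun α _ hα n r s hn _ hr hs hNn => hN n r s hn hr ?_ hNn⟩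
  · have : (12 * s : ℝ) ≤ n := by exact_mod_cast (le_max_right _ _).trans hNn
    linarith
  · exact (le_max_left _ _).trans hNn
  · rw [hs]
    gcongr
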